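/- Let $\mathbb{D}^2$ be the open unit bidisk and let $H^2(\mathbb{D}^2)$ be the Hardy space of holomorphic functions $f$ on $\mathbb{D}^2$ with $\|f\|^2=\sup_{0\le r<1}\int_{\mathbb{T}^2}|f(rz,rw)|^2\,dm<\infty$, where $dm$ is normalized Lebesgue measure on $\mathbb{T}^2$. For $p\in\mathbb{C}[z,w]$ let $[p]$ be the submodule of $H^2(\mathbb{D}^2)$ generated by $p$ (the closure of $p\,\mathbb{C}[z,w]$), let $\mathcal{N}=[p]^\perp=H^2(\mathbb{D}^2)\ominus[p]$, and let $S_z=P_{\mathcal{N}}T_z|_{\mathcal{N}}$ be the compression to $\mathcal{N}$ of the operator $T_z$ of multiplication by $z$. Say that $p$ has the divisor property if every $f\in H^2(\mathbb{D}^2)$ for which $f/p$ is holomorphic in $\mathbb{D}^2$ belongs to $[p]$. A bounded operator $T$ on a Hilbert space is reducible if it has a closed subspace, different from $\{0\}$ and from the whole space, that is invariant under $T$ and $T^*$; and $V^*(T)=\{T,T^*\}'$ denotes the von Neumann algebra of bounded operators commuting with $T$ and $T^*$. Suppose $p\in\mathbb{C}[z,w]$ has a zero in $\mathbb{D}^2$,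 has no nonconstant factor depending only on $z$, and has the divisor property. If $p(z,w)=q(z,w^n)$ for some polynomial $q\in\mathbb{C}[z,w]$ and some integer $n\ge 2$, then $S_z$ on $\mathcal{N}=[p]^\perp$ is reducible, and $\dim_{\mathbb{C}} V^*(S_z)\ge n^2$. -/

import Mathlib

namespace BidiskHardy

open Complex MeasureTheory Metric

/-- The open unit bidisk. -/
def bidisk : Set (ℂ × ℂ) := ball 0 1 ×ˢ ball 0 1

/-- The normalized mean over the torus `|z| = |w| = r` of `|f(z, w)|²`. -/
noncomputable def torusMean (f : ℂ × ℂ → ℂ) (r : ℝ) : ℝ :=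
  Real.circleAverage (fun z => Real.circleAverage (fun w => ‖f (z, w)‖ ^ 2) 0 r) 0 r

/-! ### Fourier analysis on tori inside the bidisk -/

noncomputable section Fourier

/-- Normalized Haar measure on the circle `ℝ / ℤ`. -/
local instance circleMeasureSpace : MeasureSpace UnitAddCircle := ⟨AddCircle.haarAddCircle⟩

local instance circleIsAddHaar : Measure.IsAddHaarMeasure (volume : Measure UnitAddCircle) :=
  inferInstanceAs (Measure.IsAddHaarMeasure AddCircle.haarAddCircle)

local instance circleIsProb : IsProbabilityMeasure (volume : Measure UnitAddCircle) :=
  inferInstanceAs (IsProbabilityMeasure AddCircle.haarAddCircle)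

lemma circle_integral_eq {E : Type*} [NormedAddCommGroup E] [NormedSpace ℝ E] (g : ℂ → E) (r : ℝ) :
    ∫ x : UnitAddCircle, g ((r : ℂ) * fourier 1 x) = Real.circleAverage g 0 r := by
  have h1 : (volume : Measure UnitAddCircle) = (AddCircle.measureSpace 1).volume := by
    rw [AddCircle.volume_eq_smul_haarAddCircle]
    simp; rfl
  rw [h1]
  have h2 := UnitAddCircle.intervalIntegral_preimage 0 (fun x => g ((r : ℂ) * fourier 1 x))
  refine h2.symm.trans ?_
  rw [Real.circleAverage_def]
  have h3 := intervalIntegral.integral_comp_mul_left (a := 0) (b := 1)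
    (fun θ => g (circleMap 0 r θ)) (c := 2 * Real.pi) (by positivity)
  simp only [mul_zero, mul_one] at h3
  rw [← h3, zero_add]
  refine intervalIntegral.integral_congr fun x _ => ?_
  simp only [fourier_coe_apply, circleMap]
  congr 3
  push_cast
  rw [zero_add]
  congr 2
  ring

/-- The point of the torus `|z| = r`, `|w| = s` with angles `x 0`, `x 1`. -/
def torusPt (r s : ℝ) (x : UnitAddTorus (Fin 2)) : ℂ × ℂ :=
  ((r : ℂ) * fourier 1 (x 0), (s : ℂ) * fourier 1 (x 1))

lemma norm_fourier_apply (n : ℤ) (x : UnitAddCircle) : ‖fourier n x‖ = 1 := by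
  rw [fourier_apply]; exact Circle.norm_coe _

lemma continuous_torusPt (r s : ℝ) : Continuous (torusPt r s) := by
  unfold torusPt; fun_prop

lemma pt_mem {r s : ℝ} (hr : r ∈ Set.Ico (0 : ℝ) 1) (hs : s ∈ Set.Ico (0 : ℝ) 1)
    (x y : UnitAddCircle) :
    ((r : ℂ) * fourier 1 x, (s : ℂ) * fourier 1 y) ∈ bidisk := by
  have h (r : ℝ) (hr : r ∈ Set.Ico (0 : ℝ) 1) (x : UnitAddCircle) :
      (r : ℂ) * fourier 1 x ∈ ball (0 : ℂ) 1 := by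
    rw [mem_ball_zero_iff, norm_mul, norm_fourier_apply, mul_one, norm_real, Real.norm_eq_abs,
      abs_of_nonneg hr.1]
    exact hr.2
  exact ⟨h r hr x, h s hs y⟩

lemma torus_integral_eq {E : Type*} [NormedAddCommGroup E] [NormedSpace ℝ E]
    (G : UnitAddCircle → UnitAddCircle → E) (hG : Continuous fun x : UnitAddCircle × UnitAddCircle => G x.1 x.2) :
    ∫ x : UnitAddTorus (Fin 2), G (x 0) (x 1) = ∫ a, ∫ b, G a b := by
  have h := (volume_preserving_finTwoArrow UnitAddCircle).integral_comp
    (MeasurableEquiv.finTwoArrow.measurableEmbedding) (fun x => G x.1 x.2)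
  refine h.trans ?_
  refine integral_prod (fun x : UnitAddCircle × UnitAddCircle => G x.1 x.2) ?_
  exact (hG.integrable_of_hasCompactSupport (HasCompactSupport.of_compactSpace _))

lemma integral_fourier (m : ℤ) : ∫ x : UnitAddCircle, fourier m x = if m = 0 then 1 else 0 := by
  have h := (orthonormal_iff_ite.1 (orthonormal_fourier (T := (1 : ℝ)))) 0 m
  rw [ContinuousMap.inner_toLp] at h
  simp only [fourier_zero, map_one, mul_one] at h
  refine Eq.trans h ?_
  simp only [eq_comm]

lemma fourier_pow (x : UnitAddCircle) (n : ℕ) : fourier (n : ℤ) x = fourier 1 x ^ n := by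
  induction n with
  | zero => simp
  | succ n ih => rw [Nat.cast_succ, fourier_add, ih, pow_succ]

lemma circle_coeff {h : ℂ → ℂ} (hh : DifferentiableOn ℂ h (ball 0 1)) {r : ℝ}
    (hr : r ∈ Set.Ico (0 : ℝ) 1) (k : ℤ) :
    ∫ x : UnitAddCircle, fourier (-k) x * h ((r : ℂ) * fourier 1 x) =
      if 0 ≤ k then (r : ℂ) ^ k.toNat * ((k.toNat.factorial : ℂ)⁻¹ * iteratedDeriv k.toNat h 0)
      else 0 := by
  set b : ℕ → ℂ := fun n => (n.factorial : ℂ)⁻¹ * iteratedDeriv n h 0 with hb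
  have hr1 : (r : ℂ) ∈ ball (0 : ℂ) 1 := by
    simpa [abs_of_nonneg hr.1] using hr.2
  have hser : ∀ z ∈ ball (0 : ℂ) 1, HasSum (fun n => b n * z ^ n) (h z) := by
    intro z hz
    have := Complex.hasSum_taylorSeries_on_ball hh hz
    convert! this using 2 with n
    simp only [hb, sub_zero, smul_eq_mul]
    ring
  have hsum : Summable fun n => ‖b n * (r : ℂ) ^ n‖ := (hser r hr1).summable.norm
  have hF : ∀ x : UnitAddCircle, HasSum (fun n : ℕ => (b n * (r : ℂ) ^ n) * fourier ((n : ℤ) - k) x)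
      (fourier (-k) x * h ((r : ℂ) * fourier 1 x)) := by
    intro x
    have := (hser _ (pt_mem hr hr x x).1).mul_left (fourier (-k) x)
    convert! this using 2 with n
    rw [sub_eq_add_neg, fourier_add, fourier_pow]
    ring
  have hint := hasSum_integral_of_summable_integral_norm (μ := (volume : Measure UnitAddCircle))
    (F := fun (n : ℕ) x => (b n * (r : ℂ) ^ n) * fourier ((n : ℤ) - k) x) (fun n => by
      apply Continuous.integrable_of_hasCompactSupport (by fun_prop)
        (HasCompactSupport.of_compactSpace _)) (by
      simpa only [norm_mul (b _ * _), norm_fourier_apply, mul_one, integral_const,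
        probReal_univ, one_smul] using hsum)
  have e1 : (∫ x : UnitAddCircle, ∑' n : ℕ, (b n * (r : ℂ) ^ n) * fourier ((n : ℤ) - k) x) =
      ∫ x : UnitAddCircle, fourier (-k) x * h ((r : ℂ) * fourier 1 x) :=
    integral_congr_ae (.of_forall fun x => (hF x).tsum_eq)
  rw [e1] at hint
  refine hint.unique ?_
  simp only [integral_const_mul, integral_fourier]
  split_ifs with hk
  · convert! hasSum_ite_eq k.toNat ((r : ℂ) ^ k.toNat * b k.toNat) using 2 with n
    by_cases hn : n = k.toNat
    · subst hn
      simp [hk, mul_comm]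
    · rw [if_neg (by omega), if_neg hn, mul_zero]
  · convert! hasSum_zero using 2 with n
    rw [if_neg (by omega), mul_zero]

/-- Fourier coefficients of `f` restricted to the torus `|z| = r`, `|w| = s`. -/
def torusCoeff (f : ℂ × ℂ → ℂ) (r s : ℝ) (j k : ℤ) : ℂ :=
  UnitAddTorus.mFourierCoeff (fun x => f (torusPt r s x)) ![j, k]

lemma continuous_pt {f : ℂ × ℂ → ℂ} (hf : ContinuousOn f bidisk) {r s : ℝ}
    (hr : r ∈ Set.Ico (0 : ℝ) 1) (hs : s ∈ Set.Ico (0 : ℝ) 1) :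
    Continuous fun x : UnitAddCircle × UnitAddCircle =>
      f ((r : ℂ) * fourier 1 x.1, (s : ℂ) * fourier 1 x.2) :=
  hf.comp_continuous (by fun_prop) fun x => pt_mem hr hs x.1 x.2

lemma torusCoeff_eq {f : ℂ × ℂ → ℂ} (hf : ContinuousOn f bidisk) {r s : ℝ}
    (hr : r ∈ Set.Ico (0 : ℝ) 1) (hs : s ∈ Set.Ico (0 : ℝ) 1) (j k : ℤ) :
    torusCoeff f r s j k = ∫ a : UnitAddCircle, fourier (-j) a *
      ∫ b : UnitAddCircle, fourier (-k) b * f ((r : ℂ) * fourier 1 a, (s : ℂ) * fourier 1 b) := by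
  have hc := continuous_pt hf hr hs
  have := torus_integral_eq (fun a b => fourier (-j) a * (fourier (-k) b *
      f ((r : ℂ) * fourier 1 a, (s : ℂ) * fourier 1 b)))
      (((map_continuous (fourier (-j))).comp continuous_fst).mul
        (((map_continuous (fourier (-k))).comp continuous_snd).mul hc))
  simp only [integral_const_mul] at this
  rw [← this]
  unfold torusCoeff UnitAddTorus.mFourierCoeff
  refine integral_congr_ae (.of_forall fun x => ?_)
  simp [UnitAddTorus.mFourier, torusPt, mul_assoc]

lemma torusCoeff_swap {f : ℂ × ℂ → ℂ} (hf : ContinuousOn f bidisk) {r s : ℝ}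
    (hr : r ∈ Set.Ico (0 : ℝ) 1) (hs : s ∈ Set.Ico (0 : ℝ) 1) (j k : ℤ) :
    torusCoeff f r s j k = torusCoeff (fun x => f x.swap) s r k j := by
  have hf' : ContinuousOn (fun x : ℂ × ℂ => f x.swap) bidisk :=
    hf.comp continuous_swap.continuousOn fun x hx => ⟨hx.2, hx.1⟩
  rw [torusCoeff_eq hf hr hs, torusCoeff_eq hf' hs hr]
  have hc := continuous_pt hf hr hs
  simp only [← integral_const_mul]
  rw [integral_integral_swap]
  · simp only [Prod.swap]
    refine integral_congr_ae (.of_forall fun x => integral_congr_ae (.of_forall fun y => ?_))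
    simp only
    ring
  · apply Continuous.integrable_of_hasCompactSupport _ (HasCompactSupport.of_compactSpace _)
    exact ((map_continuous (fourier (-j))).comp continuous_fst).mul
        (((map_continuous (fourier (-k))).comp continuous_snd).mul hc)

lemma half_mem : (1 / 2 : ℝ) ∈ Set.Ico (0 : ℝ) 1 := by norm_num

lemma torusCoeff_radius {f : ℂ × ℂ → ℂ} (hf : DifferentiableOn ℂ f bidisk) {r s : ℝ}
    (hr : r ∈ Set.Ico (0 : ℝ) 1) (hs : s ∈ Set.Ico (0 : ℝ) 1) (j k : ℤ) :
    torusCoeff f r s j k =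
      if 0 ≤ k then (2 * s : ℂ) ^ k.toNat * torusCoeff f r (1 / 2) j k else 0 := by
  have key (s : ℝ) (hs : s ∈ Set.Ico (0 : ℝ) 1) (a : UnitAddCircle) :=
    circle_coeff (h := fun w => f ((r : ℂ) * fourier 1 a, w)) (hf.comp (by fun_prop)
      fun w hw => ⟨(pt_mem hr hr a a).1, hw⟩) hs k
  rw [torusCoeff_eq hf.continuousOn hr hs, torusCoeff_eq hf.continuousOn hr half_mem]
  simp only [key s hs, key _ half_mem]
  split_ifs with hk
  · rw [← integral_const_mul]
    refine integral_congr_ae (.of_forall fun x => ?_)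
    have : ((1 / 2 : ℝ) : ℂ) ^ k.toNat * 2 ^ k.toNat = 1 := by
      rw [← mul_pow]; norm_num
    simp only [mul_pow]
    linear_combination (-(s : ℂ) ^ k.toNat * (fourier (-j) x *
      ((k.toNat.factorial : ℂ)⁻¹ *
        iteratedDeriv k.toNat (fun w => f ((r : ℂ) * fourier 1 x, w)) 0))) * this
  · simp

/-- The Taylor coefficients at the origin of a function holomorphic on the bidisk, as Cauchy
integrals over the torus of radius `1/2`. -/
def taylorCoeff (f : ℂ × ℂ → ℂ) (m : ℕ × ℕ) : ℂ :=
  2 ^ (m.1 + m.2) * torusCoeff f (1 / 2) (1 / 2) m.1 m.2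

lemma torusCoeff_eq_taylorCoeff {f : ℂ × ℂ → ℂ} (hf : DifferentiableOn ℂ f bidisk) {r s : ℝ}
    (hr : r ∈ Set.Ico (0 : ℝ) 1) (hs : s ∈ Set.Ico (0 : ℝ) 1) (j k : ℤ) :
    torusCoeff f r s j k = if 0 ≤ j ∧ 0 ≤ k then
      taylorCoeff f (j.toNat, k.toNat) * (r : ℂ) ^ j.toNat * (s : ℂ) ^ k.toNat else 0 := by
  have hf' : DifferentiableOn ℂ (fun x : ℂ × ℂ => f x.swap) bidisk :=
    hf.comp (f := Prod.swap)
      ((ContinuousLinearEquiv.prodComm ℂ ℂ ℂ).differentiable.differentiableOn)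
      fun x hx => ⟨hx.2, hx.1⟩
  rw [torusCoeff_radius hf hr hs, torusCoeff_swap hf.continuousOn hr half_mem,
    torusCoeff_radius hf' half_mem hr, ← torusCoeff_swap hf.continuousOn half_mem half_mem]
  by_cases hk : 0 ≤ k <;> by_cases hj : 0 ≤ j <;> simp only [hk, hj, if_true, if_false, and_self,
    and_true, and_false, mul_zero]
  rw [taylorCoeff, Int.toNat_of_nonneg hj, Int.toNat_of_nonneg hk, mul_pow, mul_pow, pow_add]
  ring

/-- The embedding of the non-negative frequencies into all frequencies. -/
def freq (m : ℕ × ℕ) : Fin 2 → ℤ := ![(m.1 : ℤ), (m.2 : ℤ)]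

lemma freq_injective : Function.Injective freq := by
  rintro ⟨a, b⟩ ⟨c, d⟩ h
  have h0 := congrFun h 0
  have h1 := congrFun h 1
  simp [freq] at h0 h1
  simp [h0, h1]

/-- The restriction of `f` to a torus, as a continuous function of the angles. -/
def restrict {f : ℂ × ℂ → ℂ} (hf : ContinuousOn f bidisk) {r s : ℝ}
    (hr : r ∈ Set.Ico (0 : ℝ) 1) (hs : s ∈ Set.Ico (0 : ℝ) 1) : C(UnitAddTorus (Fin 2), ℂ) :=
  ⟨fun x => f (torusPt r s x),
    hf.comp_continuous (continuous_torusPt r s) fun x => pt_mem hr hs (x 0) (x 1)⟩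

lemma mFourierCoeff_restrict_freq {f : ℂ × ℂ → ℂ} (hf : DifferentiableOn ℂ f bidisk) {r s : ℝ}
    (hr : r ∈ Set.Ico (0 : ℝ) 1) (hs : s ∈ Set.Ico (0 : ℝ) 1) (m : ℕ × ℕ) :
    UnitAddTorus.mFourierCoeff (restrict hf.continuousOn hr hs) (freq m) =
      taylorCoeff f m * (r : ℂ) ^ m.1 * (s : ℂ) ^ m.2 := by
  refine (torusCoeff_eq_taylorCoeff hf hr hs m.1 m.2).trans ?_
  simp

lemma mFourierCoeff_restrict_eq_zero {f : ℂ × ℂ → ℂ} (hf : DifferentiableOn ℂ f bidisk) {r s : ℝ}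
    (hr : r ∈ Set.Ico (0 : ℝ) 1) (hs : s ∈ Set.Ico (0 : ℝ) 1) (n : Fin 2 → ℤ)
    (hn : n ∉ Set.range freq) :
    UnitAddTorus.mFourierCoeff (restrict hf.continuousOn hr hs) n = 0 := by
  have h := torusCoeff_eq_taylorCoeff hf hr hs (n 0) (n 1)
  have e : ![n 0, n 1] = n := by ext i; fin_cases i <;> rfl
  rw [torusCoeff, e, if_neg] at h
  · exact h
  · rintro ⟨h0, h1⟩
    refine hn ⟨((n 0).toNat, (n 1).toNat), ?_⟩
    rw [← e]
    simp [freq, h0, h1]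

lemma torusMean_eq_integral {f : ℂ × ℂ → ℂ} (hf : ContinuousOn f bidisk) {r : ℝ}
    (hr : r ∈ Set.Ico (0 : ℝ) 1) :
    torusMean f r = ∫ x : UnitAddTorus (Fin 2), ‖f (torusPt r r x)‖ ^ 2 := by
  have hc := continuous_pt hf hr hr
  have := torus_integral_eq (fun a b => ‖f ((r : ℂ) * fourier 1 a, (r : ℂ) * fourier 1 b)‖ ^ 2)
    (hc.norm.pow 2)
  unfold torusPt
  rw [this, torusMean, ← circle_integral_eq]
  refine integral_congr_ae (.of_forall fun a => ?_)
  exact (circle_integral_eq (fun w => ‖f ((r : ℂ) * fourier 1 a, w)‖ ^ 2) r).symm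

lemma hasSum_torusMean {f : ℂ × ℂ → ℂ} (hf : DifferentiableOn ℂ f bidisk) {r : ℝ}
    (hr : r ∈ Set.Ico (0 : ℝ) 1) :
    HasSum (fun m : ℕ × ℕ => ‖taylorCoeff f m‖ ^ 2 * (r ^ (m.1 + m.2)) ^ 2) (torusMean f r) := by
  have h := UnitAddTorus.hasSum_sq_mFourierCoeff
    (ContinuousMap.toLp 2 volume ℂ (restrict hf.continuousOn hr hr))
  simp only [UnitAddTorus.mFourierCoeff_toLp] at h
  rw [← freq_injective.hasSum_iff (fun n hn => by
    rw [mFourierCoeff_restrict_eq_zero hf hr hr n hn]; simp)] at h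
  have e : ∫ t : UnitAddTorus (Fin 2),
      ‖ContinuousMap.toLp 2 volume ℂ (restrict hf.continuousOn hr hr) t‖ ^ 2 = torusMean f r := by
    rw [torusMean_eq_integral hf.continuousOn hr]
    refine integral_congr_ae ?_
    filter_upwards [ContinuousMap.coeFn_toLp (p := 2) (𝕜 := ℂ) volume
      (restrict hf.continuousOn hr hr)] with x hx
    rw [hx]
    rfl
  rw [e] at h
  convert! h using 2 with m
  rw [Function.comp, mFourierCoeff_restrict_freq hf hr hr m]
  simp only [norm_mul, norm_pow, norm_real, Real.norm_eq_abs, abs_of_nonneg hr.1]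
  ring

lemma hasSum_taylor {f : ℂ × ℂ → ℂ} (hf : DifferentiableOn ℂ f bidisk)
    (hs : ∀ r ∈ Set.Ico (0 : ℝ) 1, ∀ s ∈ Set.Ico (0 : ℝ) 1,
      Summable fun m : ℕ × ℕ => taylorCoeff f m * (r : ℂ) ^ m.1 * (s : ℂ) ^ m.2)
    {z w : ℂ} (hzw : (z, w) ∈ bidisk) :
    HasSum (fun m : ℕ × ℕ => taylorCoeff f m * z ^ m.1 * w ^ m.2) (f (z, w)) := by
  have polar (z : ℂ) (hz : z ∈ ball (0 : ℂ) 1) : ∃ r ∈ Set.Ico (0 : ℝ) 1, ∃ x : UnitAddCircle,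
      (r : ℂ) * fourier 1 x = z := by
    refine ⟨‖z‖, ⟨norm_nonneg _, by simpa using hz⟩, ((z.arg / (2 * Real.pi) : ℝ) : UnitAddCircle), ?_⟩
    rw [fourier_coe_apply]
    conv_rhs => rw [← Complex.norm_mul_exp_arg_mul_I z]
    congr 2
    have : (Real.pi : ℂ) ≠ 0 := by exact_mod_cast Real.pi_ne_zero
    push_cast
    field_simp
  obtain ⟨r, hr, x, rfl⟩ := polar z hzw.1
  obtain ⟨s, hs', y, rfl⟩ := polar w hzw.2
  have hsum : Summable (UnitAddTorus.mFourierCoeff (restrict hf.continuousOn hr hs')) := by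
    rw [← freq_injective.summable_iff (fun n hn => mFourierCoeff_restrict_eq_zero hf hr hs' n hn)]
    convert! hs r hr s hs' using 2 with m
    exact mFourierCoeff_restrict_freq hf hr hs' m
  have h := UnitAddTorus.hasSum_mFourier_series_apply_of_summable hsum ![x, y]
  rw [← freq_injective.hasSum_iff (fun n hn => by
    rw [mFourierCoeff_restrict_eq_zero hf hr hs' n hn]; simp)] at h
  convert! h using 2 with m
  rw [Function.comp, mFourierCoeff_restrict_freq hf hr hs' m]
  have : UnitAddTorus.mFourier (freq m) ![x, y] = fourier 1 x ^ m.1 * fourier 1 y ^ m.2 := by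
    rw [← fourier_pow, ← fourier_pow]
    simp [UnitAddTorus.mFourier, freq]
  rw [this, smul_eq_mul]
  ring

lemma summable_monomials {a : ℕ × ℕ → ℂ} {C : ℝ} (ha : ∀ m, ‖a m‖ ≤ C) {z w : ℂ}
    (h : (z, w) ∈ bidisk) : Summable fun m : ℕ × ℕ => ‖a m * z ^ m.1 * w ^ m.2‖ := by
  have hz : ‖z‖ < 1 := by simpa using h.1
  have hw : ‖w‖ < 1 := by simpa using h.2
  have h1 := ((summable_geometric_of_lt_one (norm_nonneg z) hz).mul_of_nonneg
    (summable_geometric_of_lt_one (norm_nonneg w) hw) (fun n => by positivity)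
    (fun n => by positivity)).mul_left C
  refine h1.of_nonneg_of_le (fun m => norm_nonneg _) fun m => ?_
  rw [norm_mul, norm_mul, norm_pow, norm_pow, mul_assoc]
  gcongr
  exact ha m

lemma hasFDerivAt_monomial {E : Type*} [NormedAddCommGroup E] [NormedSpace ℂ E]
    (φ ψ : E →L[ℂ] ℂ) (c : ℂ) (m : ℕ × ℕ) (x : E) :
    HasFDerivAt (fun x => c * φ x ^ m.1 * ψ x ^ m.2)
      ((c * (((m.1 : ℂ) * φ x ^ (m.1 - 1)) * ψ x ^ m.2)) • φ +
        (c * (φ x ^ m.1 * ((m.2 : ℂ) * ψ x ^ (m.2 - 1)))) • ψ) x := by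
  have h1 := ((hasDerivAt_pow m.1 (φ x)).comp_hasFDerivAt x φ.hasFDerivAt).const_mul c
  have h2 := (hasDerivAt_pow m.2 (ψ x)).comp_hasFDerivAt x ψ.hasFDerivAt
  refine (h1.mul h2).congr_fderiv ?_
  ext v
  simp
  ring

lemma differentiableAt_series {E : Type*} [NormedAddCommGroup E] [NormedSpace ℂ E]
    (φ ψ : E →L[ℂ] ℂ) {a : ℕ × ℕ → ℂ} {C : ℝ} (ha : ∀ m, ‖a m‖ ≤ C) {x₀ : E}
    (hz : ‖φ x₀‖ < 1) (hw : ‖ψ x₀‖ < 1) :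
    DifferentiableAt ℂ (fun x : E => ∑' m : ℕ × ℕ, a m * φ x ^ m.1 * ψ x ^ m.2) x₀ := by
  obtain ⟨R, hR, hR1⟩ := exists_between (max_lt hz hw)
  obtain ⟨hzR, hwR⟩ := max_lt_iff.1 hR
  have hR0 : 0 < R := (norm_nonneg _).trans_lt hzR
  have hC : 0 ≤ C := (norm_nonneg _).trans (ha 0)
  have s0 : Summable fun n : ℕ => R ^ n := summable_geometric_of_lt_one hR0.le hR1
  have s1 : Summable fun n : ℕ => (n : ℝ) * R ^ (n - 1) := by
    have := (hasSum_coe_mul_geometric_of_norm_lt_one (r := R)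
      (by rwa [Real.norm_eq_abs, abs_of_pos hR0])).summable.mul_right R⁻¹
    refine this.congr fun n => ?_
    cases n with
    | zero => simp
    | succ n => rw [Nat.add_sub_cancel, pow_succ]; field_simp
  have hu : Summable fun m : ℕ × ℕ =>
      C * ((((m.1 : ℝ) * R ^ (m.1 - 1)) * R ^ m.2) * ‖φ‖ +
        (R ^ m.1 * ((m.2 : ℝ) * R ^ (m.2 - 1))) * ‖ψ‖) :=
    (((s1.mul_of_nonneg s0 (fun n => by positivity) (fun n => by positivity)).mul_right _).add
      ((s0.mul_of_nonneg s1 (fun n => by positivity) (fun n => by positivity)).mul_right _)).mul_left C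
  have hopen : IsOpen (φ ⁻¹' ball 0 R ∩ ψ ⁻¹' ball 0 R) :=
    (isOpen_ball.preimage φ.continuous).inter (isOpen_ball.preimage ψ.continuous)
  have hconv : Convex ℝ (φ ⁻¹' ball 0 R ∩ ψ ⁻¹' ball 0 R) :=
    ((convex_ball (0 : ℂ) R).linear_preimage (φ.toLinearMap.restrictScalars ℝ)).inter
      ((convex_ball (0 : ℂ) R).linear_preimage (ψ.toLinearMap.restrictScalars ℝ))
  have hmem : x₀ ∈ φ ⁻¹' ball 0 R ∩ ψ ⁻¹' ball 0 R := ⟨by simpa using hzR, by simpa using hwR⟩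
  have hs0 : Summable fun m : ℕ × ℕ => a m * φ x₀ ^ m.1 * ψ x₀ ^ m.2 :=
    (summable_monomials ha (z := φ x₀) (w := ψ x₀) ⟨by simpa using hz, by simpa using hw⟩).of_norm
  refine (hasFDerivAt_tsum_of_isPreconnected (x₀ := x₀)
    (f := fun (m : ℕ × ℕ) x => a m * φ x ^ m.1 * ψ x ^ m.2)
    (f' := fun m x => (a m * (((m.1 : ℂ) * φ x ^ (m.1 - 1)) * ψ x ^ m.2)) • φ +
      (a m * (φ x ^ m.1 * ((m.2 : ℂ) * ψ x ^ (m.2 - 1)))) • ψ) hu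
    hopen hconv.isPreconnected (fun m x _ => ?_) (fun m x hx => ?_) hmem
    hs0 hmem).differentiableAt
  · exact hasFDerivAt_monomial φ ψ (a m) m x
  · have hx1 : ‖φ x‖ ≤ R := (mem_ball_zero_iff.1 hx.1).le
    have hx2 : ‖ψ x‖ ≤ R := (mem_ball_zero_iff.1 hx.2).le
    rw [mul_add]
    refine (norm_add_le _ _).trans (add_le_add ?_ ?_)
    all_goals
      simp only [norm_smul, norm_mul, norm_pow, Complex.norm_natCast]
      rw [mul_assoc ‖a m‖]
      refine mul_le_mul (ha m) ?_ (by positivity) hC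
      gcongr

lemma differentiableOn_series {a : ℕ × ℕ → ℂ} {C : ℝ} (ha : ∀ m, ‖a m‖ ≤ C) :
    DifferentiableOn ℂ (fun x : ℂ × ℂ => ∑' m : ℕ × ℕ, a m * x.1 ^ m.1 * x.2 ^ m.2) bidisk :=
  fun x hx => (differentiableAt_series (ContinuousLinearMap.fst ℂ ℂ ℂ)
    (ContinuousLinearMap.snd ℂ ℂ ℂ) ha (by simpa using hx.1)
    (by simpa using hx.2)).differentiableWithinAt

lemma integral_mFourier (n : Fin 2 → ℤ) :
    ∫ x : UnitAddTorus (Fin 2), UnitAddTorus.mFourier n x = if n = 0 then 1 else 0 := by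
  have h := (orthonormal_iff_ite.1 (UnitAddTorus.orthonormal_mFourier (d := Fin 2))) 0 n
  rw [ContinuousMap.inner_toLp] at h
  simp only [UnitAddTorus.mFourier_zero, ContinuousMap.one_apply, map_one, mul_one] at h
  refine Eq.trans h ?_
  simp only [eq_comm]

lemma taylorCoeff_series {a : ℕ × ℕ → ℂ} {C : ℝ} (ha : ∀ m, ‖a m‖ ≤ C) {f : ℂ × ℂ → ℂ}
    (hf : ∀ x ∈ bidisk, f x = ∑' m : ℕ × ℕ, a m * x.1 ^ m.1 * x.2 ^ m.2) :
    taylorCoeff f = a := by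
  have hd : DifferentiableOn ℂ f bidisk := (differentiableOn_series ha).congr hf
  have hpt : (((1 / 2 : ℝ) : ℂ), ((1 / 2 : ℝ) : ℂ)) ∈ bidisk := by
    constructor <;> simp <;> norm_num
  ext n
  set c : ℕ × ℕ → ℂ := fun m => a m * ((1 / 2 : ℝ) : ℂ) ^ m.1 * ((1 / 2 : ℝ) : ℂ) ^ m.2 with hc
  have hsum : Summable fun m => ‖c m‖ := summable_monomials ha hpt
  have hF : ∀ x : UnitAddTorus (Fin 2),
      HasSum (fun m : ℕ × ℕ => c m * UnitAddTorus.mFourier (freq m - freq n) x)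
        (UnitAddTorus.mFourier (-freq n) x • restrict hd.continuousOn half_mem half_mem x) := by
    intro x
    have hmem := pt_mem half_mem half_mem (x 0) (x 1)
    have h := ((summable_monomials ha hmem).of_norm.hasSum).mul_left
      (UnitAddTorus.mFourier (-freq n) x)
    convert! h using 2 with m
    · rw [sub_eq_add_neg, UnitAddTorus.mFourier_add]
      have : UnitAddTorus.mFourier (freq m) x = fourier 1 (x 0) ^ m.1 * fourier 1 (x 1) ^ m.2 := by
        rw [← fourier_pow, ← fourier_pow]
        simp [UnitAddTorus.mFourier, freq]
      rw [this, hc]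
      ring
    · exact hf _ hmem
  have hint := hasSum_integral_of_summable_integral_norm
    (μ := (volume : Measure (UnitAddTorus (Fin 2))))
    (F := fun (m : ℕ × ℕ) x => c m * UnitAddTorus.mFourier (freq m - freq n) x) (fun m => by
      apply Continuous.integrable_of_hasCompactSupport (by fun_prop)
        (HasCompactSupport.of_compactSpace _)) (by
      have hn (k : Fin 2 → ℤ) (x : UnitAddTorus (Fin 2)) : ‖UnitAddTorus.mFourier k x‖ = 1 := by
        simp only [UnitAddTorus.mFourier, ContinuousMap.coe_mk, norm_prod, norm_fourier_apply,
          Finset.prod_const_one]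
      simpa only [norm_mul (c _), hn, mul_one, integral_const, probReal_univ, one_smul] using hsum)
  have e1 : (∫ x : UnitAddTorus (Fin 2),
      ∑' m : ℕ × ℕ, c m * UnitAddTorus.mFourier (freq m - freq n) x) =
      UnitAddTorus.mFourierCoeff (restrict hd.continuousOn half_mem half_mem) (freq n) :=
    integral_congr_ae (.of_forall fun x => (hF x).tsum_eq)
  rw [e1, mFourierCoeff_restrict_freq hd half_mem half_mem n] at hint
  have h2 := hint.unique (a₂ := c n) (by
    simp only [integral_const_mul, integral_mFourier]
    convert! hasSum_ite_eq n (c n) using 2 with m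
    by_cases hm : m = n
    · subst hm; simp
    · rw [if_neg, if_neg hm, mul_zero]
      exact fun h => hm (freq_injective (sub_eq_zero.1 h)))
  have h3 : ((1 / 2 : ℝ) : ℂ) ≠ 0 := by norm_num
  rw [hc] at h2
  exact mul_right_cancel₀ (pow_ne_zero _ h3) (mul_right_cancel₀ (pow_ne_zero _ h3) h2)

lemma taylorCoeff_add {f g : ℂ × ℂ → ℂ} (hf : ContinuousOn f bidisk) (hg : ContinuousOn g bidisk) :
    taylorCoeff (f + g) = taylorCoeff f + taylorCoeff g := by
  ext m
  have h (f : ℂ × ℂ → ℂ) (hf : ContinuousOn f bidisk) : Integrable fun x : UnitAddTorus (Fin 2) =>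
      UnitAddTorus.mFourier (-![(m.1 : ℤ), (m.2 : ℤ)]) x • f (torusPt (1 / 2) (1 / 2) x) :=
    Continuous.integrable_of_hasCompactSupport
      (((UnitAddTorus.mFourier (-![(m.1 : ℤ), (m.2 : ℤ)])) *
        restrict hf half_mem half_mem).continuous) (HasCompactSupport.of_compactSpace _)
  have := integral_add (h f hf) (h g hg)
  simp only [taylorCoeff, torusCoeff, UnitAddTorus.mFourierCoeff, Pi.add_apply, smul_add] at this ⊢
  rw [this, mul_add]

lemma taylorCoeff_smul (c : ℂ) (f : ℂ × ℂ → ℂ) : taylorCoeff (c • f) = c • taylorCoeff f := by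
  ext m
  simp only [taylorCoeff, torusCoeff, UnitAddTorus.mFourierCoeff, Pi.smul_apply, smul_eq_mul,
    mul_left_comm _ c, integral_const_mul]

lemma torusMean_nonneg (f : ℂ × ℂ → ℂ) (r : ℝ) : 0 ≤ torusMean f r := by
  have h (g : ℂ → ℝ) (hg : ∀ z, 0 ≤ g z) : 0 ≤ Real.circleAverage g 0 r := by
    rw [Real.circleAverage_def]
    exact smul_nonneg (by positivity)
      (intervalIntegral.integral_nonneg (by positivity) fun x _ => hg _)
  exact h _ fun z => h _ fun w => by positivity

lemma torusMean_le {f g : ℂ × ℂ → ℂ} (hf : ContinuousOn f bidisk) (hg : ContinuousOn g bidisk)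
    {C : ℝ} (h : ∀ x ∈ bidisk, ‖f x‖ ^ 2 ≤ C * ‖g x‖ ^ 2) {r : ℝ} (hr : r ∈ Set.Ico (0 : ℝ) 1) :
    torusMean f r ≤ C * torusMean g r := by
  rw [torusMean_eq_integral hf hr, torusMean_eq_integral hg hr, ← integral_const_mul]
  refine integral_mono ?_ ?_ fun x => h _ (pt_mem hr hr (x 0) (x 1))
  · exact Continuous.integrable_of_hasCompactSupport ((restrict hf hr hr).continuous.norm.pow 2)
      (HasCompactSupport.of_compactSpace _)
  · exact Continuous.integrable_of_hasCompactSupport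
      (((restrict hg hr hr).continuous.norm.pow 2).const_mul C)
      (HasCompactSupport.of_compactSpace _)

lemma sum_le_of_bound {f : ℂ × ℂ → ℂ} (hf : DifferentiableOn ℂ f bidisk) {B : ℝ}
    (hB : B ∈ upperBounds (torusMean f '' Set.Ico 0 1)) (S : Finset (ℕ × ℕ)) :
    ∑ m ∈ S, ‖taylorCoeff f m‖ ^ 2 ≤ B := by
  have hcont : Continuous fun r : ℝ => ∑ m ∈ S, ‖taylorCoeff f m‖ ^ 2 * (r ^ (m.1 + m.2)) ^ 2 := by
    fun_prop
  have ht := (hcont.tendsto 1).mono_left (nhdsWithin_le_nhds (s := Set.Iio 1))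
  simp only [one_pow, mul_one] at ht
  refine le_of_tendsto ht ?_
  filter_upwards [Ico_mem_nhdsLT (show (0 : ℝ) < 1 by norm_num)] with r hr
  exact (sum_le_hasSum S (fun m _ => by positivity) (hasSum_torusMean hf hr)).trans
    (hB ⟨r, hr, rfl⟩)

lemma isLUB_torusMean {f : ℂ × ℂ → ℂ} (hf : DifferentiableOn ℂ f bidisk)
    (hs : Summable fun m => ‖taylorCoeff f m‖ ^ 2) :
    IsLUB (torusMean f '' Set.Ico 0 1) (∑' m, ‖taylorCoeff f m‖ ^ 2) := by
  constructor
  · rintro _ ⟨r, hr, rfl⟩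
    refine hasSum_le (fun m => ?_) (hasSum_torusMean hf hr) hs.hasSum
    exact mul_le_of_le_one_right (by positivity)
      (pow_le_one₀ (pow_nonneg hr.1 _) (pow_le_one₀ hr.1 hr.2.le))
  · intro B hB
    refine hs.tsum_le_of_sum_le fun S => ?_
    exact sum_le_of_bound hf hB S

lemma summable_of_bddAbove {f : ℂ × ℂ → ℂ} (hf : DifferentiableOn ℂ f bidisk)
    (hB : BddAbove (torusMean f '' Set.Ico 0 1)) : Summable fun m => ‖taylorCoeff f m‖ ^ 2 := by
  obtain ⟨B, hB⟩ := hB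
  exact summable_of_sum_le (fun m => by positivity) (sum_le_of_bound hf hB)

end Fourier

/-! ### The Hardy space over the bidisk -/

noncomputable section Hardy

/-- Holomorphic functions `f` on the bidisk with `sup_{0 ≤ r < 1} ∫ |f(rz, rw)|² dm < ∞`.
A function on the bidisk is represented by its extension by zero to `ℂ × ℂ`. -/
def hardySubmodule : Submodule ℂ (ℂ × ℂ → ℂ) where
  carrier := {f | DifferentiableOn ℂ f bidisk ∧ (∀ x ∉ bidisk, f x = 0) ∧
    BddAbove (torusMean f '' Set.Ico 0 1)}
  zero_mem' := by
    refine ⟨differentiableOn_const 0, fun _ _ => rfl, 0, ?_⟩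
    rintro _ ⟨r, -, rfl⟩
    simp [torusMean, Real.circleAverage_def]
  add_mem' := by
    rintro f g ⟨hf, hf0, hfB⟩ ⟨hg, hg0, hgB⟩
    refine ⟨hf.add hg, fun x hx => by simp [hf0 x hx, hg0 x hx], ?_⟩
    have hs : Summable fun m => ‖taylorCoeff (f + g) m‖ ^ 2 := by
      have h1 := ((summable_of_bddAbove hf hfB).add (summable_of_bddAbove hg hgB)).mul_left 2
      refine h1.of_nonneg_of_le (fun m => by positivity) fun m => ?_
      rw [taylorCoeff_add hf.continuousOn hg.continuousOn, Pi.add_apply]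
      have h2 := norm_add_le (taylorCoeff f m) (taylorCoeff g m)
      nlinarith [sq_nonneg (‖taylorCoeff f m‖ - ‖taylorCoeff g m‖),
        norm_nonneg (taylorCoeff f m + taylorCoeff g m)]
    exact (isLUB_torusMean (hf.add hg) hs).bddAbove
  smul_mem' := by
    rintro c f ⟨hf, hf0, hfB⟩
    refine ⟨hf.const_smul c, fun x hx => by simp [hf0 x hx], ?_⟩
    obtain ⟨B, hB⟩ := hfB
    refine ⟨‖c‖ ^ 2 * B, ?_⟩
    rintro _ ⟨r, hr, rfl⟩
    refine (torusMean_le (hf.const_smul c).continuousOn hf.continuousOn (C := ‖c‖ ^ 2)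
      (fun x _ => ?_) hr).trans (by gcongr; exact hB ⟨r, hr, rfl⟩)
    rw [Pi.smul_apply, norm_smul, mul_pow]

/-- The Hardy space `H²(𝔻²)`. -/
def H2 : Type := hardySubmodule

instance : AddCommGroup H2 := inferInstanceAs (AddCommGroup hardySubmodule)

instance : Module ℂ H2 := inferInstanceAs (Module ℂ hardySubmodule)

instance : CoeFun H2 fun _ => ℂ × ℂ → ℂ := ⟨fun f => f.1⟩

/-- Two elements of `H²` that agree on the bidisk are equal. -/
lemma H2.ext {f g : H2} (h : ∀ x ∈ bidisk, f x = g x) : f = g := by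
  refine Subtype.ext (funext fun x => ?_)
  by_cases hx : x ∈ bidisk
  · exact h x hx
  · exact (f.2.2.1 x hx).trans (g.2.2.1 x hx).symm

lemma H2.memℓp (f : H2) : Memℓp (taylorCoeff f) 2 := by
  rw [memℓp_gen_iff (by simp)]
  simpa using summable_of_bddAbove f.2.1 f.2.2.2

/-- The Taylor coefficients of an element of `H²`, as a linear map into `ℓ²`. -/
def toCoeff : H2 →ₗ[ℂ] lp (fun _ : ℕ × ℕ => ℂ) 2 where
  toFun f := ⟨taylorCoeff f, f.memℓp⟩
  map_add' f g := Subtype.ext (taylorCoeff_add f.2.1.continuousOn g.2.1.continuousOn)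
  map_smul' c f := Subtype.ext (taylorCoeff_smul c f)

lemma toCoeff_apply (f : H2) (m : ℕ × ℕ) : toCoeff f m = taylorCoeff f m := rfl

lemma H2.hasSum (f : H2) {z w : ℂ} (h : (z, w) ∈ bidisk) :
    HasSum (fun m : ℕ × ℕ => toCoeff f m * z ^ m.1 * w ^ m.2) (f (z, w)) := by
  refine hasSum_taylor f.2.1 (fun r hr s hs => ?_) h
  refine (summable_monomials (C := ‖toCoeff f‖) (a := taylorCoeff f)
    (fun m => lp.norm_apply_le_norm (by simp) (toCoeff f) m) ?_).of_norm
  simpa using pt_mem hr hs 0 0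

lemma toCoeff_bijective : Function.Bijective toCoeff := by
  constructor
  · intro f g hfg
    refine H2.ext fun x hx => (f.hasSum hx).unique ?_
    rw [hfg]
    exact g.hasSum hx
  · intro a
    classical
    have ha : ∀ m, ‖a m‖ ≤ ‖a‖ := fun m => lp.norm_apply_le_norm (by simp) a m
    set f : ℂ × ℂ → ℂ :=
      bidisk.indicator fun x => ∑' m : ℕ × ℕ, a m * x.1 ^ m.1 * x.2 ^ m.2 with hf
    have hfx : ∀ x ∈ bidisk, f x = ∑' m : ℕ × ℕ, a m * x.1 ^ m.1 * x.2 ^ m.2 :=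
      fun x hx => Set.indicator_of_mem hx _
    have hd : DifferentiableOn ℂ f bidisk := (differentiableOn_series ha).congr hfx
    have hc : taylorCoeff f = a := taylorCoeff_series ha hfx
    have hs : Summable fun m => ‖taylorCoeff f m‖ ^ 2 := by
      have := lp.memℓp a
      rw [memℓp_gen_iff (by simp)] at this
      rw [hc]
      simpa using this
    exact ⟨⟨f, hd, fun x hx => Set.indicator_of_notMem hx _, (isLUB_torusMean hd hs).bddAbove⟩,
      Subtype.ext hc⟩

/-- The norm `‖f‖² = sup_{0 ≤ r < 1} ∫ |f(rz, rw)|² dm`. -/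
def hardyNorm (f : H2) : ℝ := √(sSup (torusMean f '' Set.Ico 0 1))

lemma hardyNorm_eq (f : H2) : hardyNorm f = ‖toCoeff f‖ := by
  have h := (isLUB_torusMean f.2.1 (summable_of_bddAbove f.2.1 f.2.2.2)).csSup_eq
    ⟨_, 0, by simp, rfl⟩
  have h2 := lp.norm_rpow_eq_tsum (p := 2) (by simp) (toCoeff f)
  simp only [ENNReal.toReal_ofNat, Real.rpow_ofNat] at h2
  rw [hardyNorm, h, Real.sqrt_eq_iff_mul_self_eq (by positivity) (by positivity), ← sq, h2]
  rfl

instance : NormedAddCommGroup H2 := AddGroupNorm.toNormedAddCommGroup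
  { toFun := hardyNorm
    map_zero' := by simp [hardyNorm_eq]
    add_le' := fun f g => by simpa [hardyNorm_eq] using norm_add_le _ _
    neg' := fun f => by simp [hardyNorm_eq]
    eq_zero_of_map_eq_zero' := fun f hf => toCoeff_bijective.1 (by
      rw [hardyNorm_eq, norm_eq_zero] at hf
      rw [hf, map_zero]) }

lemma H2.norm_def (f : H2) : ‖f‖ = hardyNorm f := rfl

instance : NormedSpace ℂ H2 where
  norm_smul_le c f := by simp [H2.norm_def, hardyNorm_eq, norm_smul]

instance : InnerProductSpace ℂ H2 := InnerProductSpace.ofNorm ℂ fun f g => by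
  simpa only [H2.norm_def, hardyNorm_eq, map_add, map_sub, sq] using
    parallelogram_law_with_norm ℂ (toCoeff f) (toCoeff g)

/-- The unitary identification of `H²(𝔻²)` with `ℓ²(ℕ × ℕ)` by Taylor coefficients. -/
def coeffEquiv : H2 ≃ₗᵢ[ℂ] lp (fun _ : ℕ × ℕ => ℂ) 2 where
  toLinearEquiv := LinearEquiv.ofBijective toCoeff toCoeff_bijective
  norm_map' f := (hardyNorm_eq f).symm

instance : CompleteSpace H2 :=
  (completeSpace_congr coeffEquiv.toIsometryEquiv.isometry.isUniformEmbedding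
    (e := coeffEquiv.toEquiv)).2 inferInstance

/-! ### Polynomials, multiplication operators and quotient modules -/

/-- The value of `p ∈ ℂ[z, w]` at a point; `z` is the variable `0` and `w` the variable `1`. -/
def evalAt (p : MvPolynomial (Fin 2) ℂ) (x : ℂ × ℂ) : ℂ := MvPolynomial.eval ![x.1, x.2] p

lemma differentiable_evalAt (p : MvPolynomial (Fin 2) ℂ) : Differentiable ℂ (evalAt p) := by
  unfold evalAt
  induction p using MvPolynomial.induction_on with
  | C a => simp
  | add p q hp hq =>
    simp only [map_add]
    exact hp.add hq
  | mul_X p i hp =>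
    simp only [map_mul, MvPolynomial.eval_X]
    refine hp.mul ?_
    fin_cases i
    · exact differentiable_fst
    · exact differentiable_snd

lemma exists_bound_evalAt (p : MvPolynomial (Fin 2) ℂ) :
    ∃ C : ℝ, 0 ≤ C ∧ ∀ x ∈ bidisk, ‖evalAt p x‖ ≤ C := by
  obtain ⟨C, hC⟩ := ((isCompact_closedBall (0 : ℂ) 1).prod (isCompact_closedBall (0 : ℂ) 1))
    |>.exists_bound_of_continuousOn (differentiable_evalAt p).continuous.continuousOn
  exact ⟨C, (norm_nonneg _).trans (hC (0, 0) (by simp)), fun x hx =>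
    hC x ⟨ball_subset_closedBall hx.1, ball_subset_closedBall hx.2⟩⟩

lemma mul_mem_hardy (p : MvPolynomial (Fin 2) ℂ) (f : H2) :
    (fun x => evalAt p x * f x) ∈ hardySubmodule := by
  obtain ⟨C, -, hC⟩ := exists_bound_evalAt p
  have hd : DifferentiableOn ℂ (fun x => evalAt p x * f x) bidisk :=
    (differentiable_evalAt p).differentiableOn.mul f.2.1
  obtain ⟨B, hB⟩ := f.2.2.2
  refine ⟨hd, fun x hx => by simp [f.2.2.1 x hx], C ^ 2 * B, ?_⟩
  rintro _ ⟨r, hr, rfl⟩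
  refine (torusMean_le hd.continuousOn f.2.1.continuousOn (C := C ^ 2) (fun x hx => ?_) hr).trans
    (by gcongr; exact hB ⟨r, hr, rfl⟩)
  rw [norm_mul, mul_pow]
  gcongr
  exact hC x hx

/-- The analytic Toeplitz operator `f ↦ p f` on `H²(𝔻²)`. -/
def toeplitz (p : MvPolynomial (Fin 2) ℂ) : H2 →L[ℂ] H2 :=
  LinearMap.mkContinuousOfExistsBound
    { toFun := fun f => ⟨fun x => evalAt p x * f x, mul_mem_hardy p f⟩
      map_add' := fun f g => Subtype.ext (funext fun x => mul_add (evalAt p x) (f x) (g x))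
      map_smul' := fun c f => Subtype.ext (funext fun x => mul_left_comm (evalAt p x) c (f x)) }
    (by
      obtain ⟨C, hC0, hC⟩ := exists_bound_evalAt p
      refine ⟨C, fun f => ?_⟩
      rw [H2.norm_def, H2.norm_def, hardyNorm, hardyNorm]
      refine Real.sqrt_le_iff.2 ⟨by positivity, ?_⟩
      rw [mul_pow, Real.sq_sqrt
        (Real.sSup_nonneg (by rintro _ ⟨r, -, rfl⟩; exact torusMean_nonneg _ _))]
      refine csSup_le ⟨_, 0, by simp, rfl⟩ ?_
      rintro _ ⟨r, hr, rfl⟩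
      refine (torusMean_le (mul_mem_hardy p f).1.continuousOn f.2.1.continuousOn (C := C ^ 2)
        (fun x hx => ?_) hr).trans (by gcongr; exact le_csSup f.2.2.2 ⟨r, hr, rfl⟩)
      rw [norm_mul, mul_pow]
      gcongr
      exact hC x hx)

/-- The constant function `1` as an element of `H²(𝔻²)`. -/
def one : H2 := ⟨bidisk.indicator 1, by
  have hd : DifferentiableOn ℂ (bidisk.indicator (1 : ℂ × ℂ → ℂ)) bidisk :=
    (differentiableOn_const (1 : ℂ)).congr fun x hx => Set.indicator_of_mem hx _
  refine ⟨hd, fun x hx => Set.indicator_of_notMem hx _, 1, ?_⟩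
  rintro _ ⟨r, hr, rfl⟩
  have h (z : ℂ) (hz : z ∈ sphere (0 : ℂ) |r|) : z ∈ ball (0 : ℂ) 1 := by
    rw [abs_of_nonneg hr.1, mem_sphere_zero_iff_norm] at hz
    simpa [hz] using hr.2
  have h1 : torusMean (bidisk.indicator 1) r = Real.circleAverage (fun _ => (1 : ℝ)) 0 r := by
    refine Real.circleAverage_congr_sphere fun z hz => ?_
    refine (Real.circleAverage_congr_sphere (f₂ := fun _ => (1 : ℝ)) fun w hw => ?_).trans ?_
    · simp [Set.indicator_of_mem (show (z, w) ∈ bidisk from ⟨h z hz, h w hw⟩)]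
    · exact Real.circleAverage_const _ _ _
  rw [h1, Real.circleAverage_const]⟩

/-- A polynomial as an element of `H²(𝔻²)`. -/
def polyH2 (p : MvPolynomial (Fin 2) ℂ) : H2 := toeplitz p one

lemma polyH2_apply (p : MvPolynomial (Fin 2) ℂ) {x : ℂ × ℂ} (hx : x ∈ bidisk) :
    polyH2 p x = evalAt p x := by
  change evalAt p x * bidisk.indicator 1 x = _
  rw [Set.indicator_of_mem hx, Pi.one_apply, mul_one]

/-- The submodule `[p]` of `H²(𝔻²)` generated by `p`: the smallest closed subspace that contains
`p` and is invariant under multiplication by `z` and by `w`, i.e. the closure of `p ℂ[z, w]`. -/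
def principal (p : MvPolynomial (Fin 2) ℂ) : Submodule ℂ H2 :=
  (Submodule.span ℂ (Set.range fun g => polyH2 (g * p))).topologicalClosure

/-- The quotient module `[p]^⊥ = H²(𝔻²) ⊖ [p]`. -/
abbrev quotientModule (p : MvPolynomial (Fin 2) ℂ) : Submodule ℂ H2 := (principal p)ᗮ

/-- The compressed shift `S_z = P_N T_z|_N` on `N = [p]^⊥`. -/
def compressedShift (p : MvPolynomial (Fin 2) ℂ) :
    quotientModule p →L[ℂ] quotientModule p :=
  (quotientModule p).orthogonalProjectionOnto ∘L toeplitz (MvPolynomial.X 0) ∘L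
    (quotientModule p).subtypeL

/-- `p` has no nonconstant factor that depends only on the variable `z`. -/
def NoFactorInZ (p : MvPolynomial (Fin 2) ℂ) : Prop :=
  ∀ g : Polynomial ℂ,
    Polynomial.aeval (MvPolynomial.X 0 : MvPolynomial (Fin 2) ℂ) g ∣ p → g.natDegree = 0

/-- `p` has the divisor property: every `f ∈ H²(𝔻²)` such that `f / p` is (extends to) a
holomorphic function on the bidisk belongs to `[p]`. -/
def HasDivisorProperty (p : MvPolynomial (Fin 2) ℂ) : Prop :=
  ∀ f : H2, (∃ h : ℂ × ℂ → ℂ, DifferentiableOn ℂ h bidisk ∧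
    ∀ x ∈ bidisk, f x = evalAt p x * h x) → f ∈ principal p

end Hardy

/-! ### Reducing subspaces -/

section Operators

variable {H : Type*} [NormedAddCommGroup H] [InnerProductSpace ℂ H] [CompleteSpace H]

/-- `M` is a reducing subspace of `T`: it is closed and invariant under `T` and `T*`. -/
def IsReducingSubspace (T : H →L[ℂ] H) (M : Submodule ℂ H) : Prop :=
  IsClosed (M : Set H) ∧ (∀ x ∈ M, T x ∈ M) ∧ ∀ x ∈ M, ContinuousLinearMap.adjoint T x ∈ M

/-- `T` is reducible: it has a reducing subspace other than `{0}` and the whole space. -/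
def IsReducible (T : H →L[ℂ] H) : Prop :=
  ∃ M : Submodule ℂ H, IsReducingSubspace T M ∧ M ≠ ⊥ ∧ M ≠ ⊤

/-- The von Neumann algebra `V*(T) = {T, T*}'`. -/
noncomputable def commutantAlgebra (T : H →L[ℂ] H) : VonNeumannAlgebra H where
  toStarSubalgebra := StarSubalgebra.centralizer ℂ {T, ContinuousLinearMap.adjoint T}
  centralizer_centralizer' := by simp

end Operators

end BidiskHardy

/-!
Every function on the bidisk is uniquely `∑ᵢ wⁱ fᵢ(z, wⁿ)` with `0 ≤ i < n`. In `H²(𝔻²)` this says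
that the isometries `Vᵢ f = wⁱ f(z, wⁿ)` have pairwise orthogonal ranges which span the space. They
permute monomials, so that each `Vᵢ` and each `Vᵢ*` commutes with `T_z`. For `p = q(z, wⁿ)` moreover
`Vᵢ` carries `[q]` into `[p]` and `Vᵢ*` carries `[p]` into `[q]`. Passing to orthogonal complements,
`Vᵢ` restricts to an isometry `[q]^⊥ → [p]^⊥` which, like its adjoint, intertwines the compressed
shifts. Hence the `n²` matrix units `Vᵢ Vⱼ*` are linearly independent elements of `V*(S_z)`, and the
kernel of `Vᵢ Vᵢ*` is a nontrivial reducing subspace.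
-/

namespace BidiskHardy

open MvPolynomial
open scoped InnerProduct InnerProductSpace

/-! ### Intertwining families of isometries -/

section Intertwining

open ContinuousLinearMap

variable {𝕜 H K ι : Type*} [RCLike 𝕜]
  [NormedAddCommGroup H] [InnerProductSpace 𝕜 H] [CompleteSpace H]
  [NormedAddCommGroup K] [InnerProductSpace 𝕜 K] [CompleteSpace K]

/-- The `u i` are isometries `K → H` with pairwise orthogonal ranges which, together with their
adjoints, intertwine `T` and `S`. Such a family exhibits a multiple of `S` as a direct summand of
`T`. -/
structure IsIntertwiningFamily (T : H →L[𝕜] H) (S : K →L[𝕜] K) (u : ι → K →L[𝕜] H) : Prop where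
  adjoint_comp_self (i : ι) : (u i)† ∘L u i = 1
  adjoint_comp_of_ne {i j : ι} (hij : i ≠ j) : (u i)† ∘L u j = 0
  comp_eq (i : ι) : T ∘L u i = u i ∘L S
  adjoint_comp_eq (i : ι) : (u i)† ∘L T = S ∘L (u i)†

namespace IsIntertwiningFamily

variable {T : H →L[𝕜] H} {S : K →L[𝕜] K} {u : ι → K →L[𝕜] H}

lemma adjoint_apply_apply [DecidableEq ι] (hu : IsIntertwiningFamily T S u) (i j : ι) (x : K) :
    ((u i)†) (u j x) = if i = j then x else 0 := by
  split_ifs with hij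
  · subst hij
    exact congr($(hu.adjoint_comp_self i) x)
  · exact congr($(hu.adjoint_comp_of_ne hij) x)

lemma apply_ne_zero (hu : IsIntertwiningFamily T S u) (i : ι) {x : K} (hx : x ≠ 0) :
    u i x ≠ 0 := by
  classical
  intro h
  exact hx (by simpa [h] using (hu.adjoint_apply_apply i i x).symm)

lemma comp_matrixUnit (hu : IsIntertwiningFamily T S u) (i j : ι) :
    T ∘L (u i ∘L (u j)†) = (u i ∘L (u j)†) ∘L T := by
  rw [← comp_assoc, hu.comp_eq, comp_assoc, comp_assoc, hu.adjoint_comp_eq]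

lemma adjoint_comp_matrixUnit (hu : IsIntertwiningFamily T S u) (i j : ι) :
    T† ∘L (u i ∘L (u j)†) = (u i ∘L (u j)†) ∘L T† := by
  simpa only [adjoint_comp, adjoint_adjoint] using congr(($(hu.comp_matrixUnit j i))†).symm

lemma linearIndependent_matrixUnit [Nontrivial K] (hu : IsIntertwiningFamily T S u) :
    LinearIndependent 𝕜 fun m : ι × ι => u m.1 ∘L (u m.2)† := by
  classical
  obtain ⟨x, hx⟩ := exists_ne (0 : K)
  rw [linearIndependent_iff']
  rintro s c hc ⟨k, l⟩ hkl
  have hentry : ∑ m ∈ s, c m • (if l = m.2 then if k = m.1 then x else 0 else 0) = 0 := by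
    have := congr(((u k)†) ($hc (u l x)))
    simpa [sum_apply, hu.adjoint_apply_apply, apply_ite, eq_comm] using this
  rw [Finset.sum_eq_single_of_mem (k, l) hkl] at hentry
  · simpa [hx] using hentry
  · rintro ⟨i, j⟩ - hij
    have : l = j → k ≠ i := fun hj hi => hij (by rw [hi, hj])
    simp_all

end IsIntertwiningFamily

end Intertwining

/-! ### The commutant -/

section Commutant

open ContinuousLinearMap

variable {H K ι : Type*}
  [NormedAddCommGroup H] [InnerProductSpace ℂ H] [CompleteSpace H]
  [NormedAddCommGroup K] [InnerProductSpace ℂ K] [CompleteSpace K]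
  {T A : H →L[ℂ] H} {S : K →L[ℂ] K} {u : ι → K →L[ℂ] H}

lemma mem_commutantAlgebra (h : T ∘L A = A ∘L T) (hadj : T† ∘L A = A ∘L T†) :
    A ∈ (commutantAlgebra T).toStarSubalgebra := by
  change A ∈ StarSubalgebra.centralizer ℂ {T, T†}
  rw [StarSubalgebra.mem_centralizer_iff]
  rintro g (rfl | rfl)
  · exact ⟨h, hadj⟩
  · rw [star_eq_adjoint, adjoint_adjoint]
    exact ⟨hadj, h⟩

lemma isReducingSubspace_ker (h : T ∘L A = A ∘L T) (hadj : T† ∘L A = A ∘L T†) :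
    IsReducingSubspace T A.ker := by
  refine ⟨A.isClosed_ker, fun x hx => ?_, fun x hx => ?_⟩
  · have hAx : A x = 0 := hx
    exact congr($h x).symm.trans (by simp [hAx])
  · have hAx : A x = 0 := hx
    exact congr($hadj x).symm.trans (by simp [hAx])

namespace IsIntertwiningFamily

lemma isReducible [Nontrivial ι] [Nontrivial K] (hu : IsIntertwiningFamily T S u) :
    IsReducible T := by
  classical
  obtain ⟨i, j, hij⟩ := exists_pair_ne ι
  obtain ⟨x, hx⟩ := exists_ne (0 : K)
  refine ⟨(u i ∘L (u i)†).ker,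
    isReducingSubspace_ker (hu.comp_matrixUnit i i) (hu.adjoint_comp_matrixUnit i i), ?_, ?_⟩
  · rw [Submodule.ne_bot_iff]
    exact ⟨u j x, by simp [hu.adjoint_apply_apply, hij], hu.apply_ne_zero j hx⟩
  · intro htop
    have hker : u i x ∈ (u i ∘L (u i)†).ker := htop ▸ Submodule.mem_top
    exact hu.apply_ne_zero i hx (by simpa [hu.adjoint_apply_apply] using hker)

lemma card_sq_le_rank_commutantAlgebra [Fintype ι] [Nontrivial K]
    (hu : IsIntertwiningFamily T S u) :
    ((Fintype.card ι ^ 2 : ℕ) : Cardinal) ≤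
      Module.rank ℂ (commutantAlgebra T).toStarSubalgebra := by
  let matrixUnit (m : ι × ι) : (commutantAlgebra T).toStarSubalgebra :=
    ⟨u m.1 ∘L (u m.2)†, mem_commutantAlgebra (hu.comp_matrixUnit m.1 m.2)
      (hu.adjoint_comp_matrixUnit m.1 m.2)⟩
  have hindep : LinearIndependent ℂ matrixUnit :=
    .of_comp (commutantAlgebra T).toStarSubalgebra.toSubalgebra.val.toLinearMap
      hu.linearIndependent_matrixUnit
  exact Cardinal.lift_le.1 (by simpa [sq] using hindep.cardinal_lift_le_rank)

end IsIntertwiningFamily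

end Commutant

/-! ### Compressions -/

section Compression

open ContinuousLinearMap

variable {𝕜 H K ι : Type*} [RCLike 𝕜]
  [NormedAddCommGroup H] [InnerProductSpace 𝕜 H] [NormedAddCommGroup K] [InnerProductSpace 𝕜 K]

/-- The compression `P_N A|_N` of the operator `A` to the subspace `N`. -/
noncomputable def compression (N : Submodule 𝕜 H) [N.HasOrthogonalProjection] (A : H →L[𝕜] H) :
    N →L[𝕜] N :=
  N.orthogonalProjectionOnto ∘L A ∘L N.subtypeL

lemma inner_compression_right (N : Submodule 𝕜 H) [N.HasOrthogonalProjection] (A : H →L[𝕜] H)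
    (f g : N) : ⟪g, compression N A f⟫_𝕜 = ⟪(g : H), A f⟫_𝕜 :=
  N.inner_orthogonalProjectionOnto_eq_of_mem_left g (A f)

variable [CompleteSpace H] [CompleteSpace K]

lemma apply_mem_orthogonal {V : K →L[𝕜] H} {M₁ : Submodule 𝕜 K} {M₂ : Submodule 𝕜 H}
    (hV : ∀ g ∈ M₂, (V†) g ∈ M₁) : ∀ f ∈ M₁ᗮ, V f ∈ M₂ᗮ := fun f hf g hg => by
  rw [← adjoint_inner_left]
  exact hf _ (hV g hg)

variable {N₁ : Submodule 𝕜 K} {N₂ : Submodule 𝕜 H} [CompleteSpace N₁] [CompleteSpace N₂]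

lemma adjoint_restrict {V : K →L[𝕜] H} (hV : ∀ f ∈ N₁, V f ∈ N₂) (hVadj : ∀ g ∈ N₂, (V†) g ∈ N₁) :
    (V.restrict hV)† = V†.restrict hVadj := by
  refine ((eq_adjoint_iff _ _).2 fun g f => ?_).symm
  exact adjoint_inner_left V f g

lemma compression_comp_restrict {V : K →L[𝕜] H} {A : H →L[𝕜] H} {B : K →L[𝕜] K}
    (hV : ∀ f ∈ N₁, V f ∈ N₂) (hVadj : ∀ g ∈ N₂, (V†) g ∈ N₁) (hAB : A ∘L V = V ∘L B) :
    compression N₂ A ∘L V.restrict hV = V.restrict hV ∘L compression N₁ B := by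
  ext1 f
  refine ext_inner_left 𝕜 fun g => ?_
  calc ⟪g, compression N₂ A (V.restrict hV f)⟫_𝕜
      = ⟪(g : H), A (V f)⟫_𝕜 := inner_compression_right N₂ A _ g
    _ = ⟪(V†) g, B f⟫_𝕜 := by rw [adjoint_inner_left]; exact congr(⟪(g : H), $hAB f⟫_𝕜)
    _ = ⟪V†.restrict hVadj g, compression N₁ B f⟫_𝕜 :=
      (inner_compression_right N₁ B f (V†.restrict hVadj g)).symm
    _ = ⟪g, V.restrict hV (compression N₁ B f)⟫_𝕜 := by
      rw [← adjoint_restrict hV, adjoint_inner_left]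

theorem IsIntertwiningFamily.compression {A : H →L[𝕜] H} {B : K →L[𝕜] K} {u : ι → K →L[𝕜] H}
    (hu : IsIntertwiningFamily A B u) (h : ∀ i, ∀ f ∈ N₁, u i f ∈ N₂)
    (hadj : ∀ i, ∀ g ∈ N₂, ((u i)†) g ∈ N₁) :
    IsIntertwiningFamily (compression N₂ A) (compression N₁ B) fun i => (u i).restrict (h i) where
  adjoint_comp_self i := by
    ext f
    rw [adjoint_restrict (h i) (hadj i)]
    exact congr($(hu.adjoint_comp_self i) f)
  adjoint_comp_of_ne {i j} hij := by
    ext f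
    rw [adjoint_restrict (h i) (hadj i)]
    exact congr($(hu.adjoint_comp_of_ne hij) f)
  comp_eq i := compression_comp_restrict (h i) (hadj i) (hu.comp_eq i)
  adjoint_comp_eq i := by
    rw [adjoint_restrict (h i) (hadj i)]
    refine (compression_comp_restrict (hadj i) ?_ (hu.adjoint_comp_eq i).symm).symm
    simpa only [adjoint_adjoint] using h i

end Compression

/-! ### Isometries that embed a Hilbert basis into another -/

section BasisEmbedding

open ContinuousLinearMap

variable {𝕜 E F ι κ α : Type*} [RCLike 𝕜]
  [NormedAddCommGroup E] [InnerProductSpace 𝕜 E]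
  [NormedAddCommGroup F] [InnerProductSpace 𝕜 F] [CompleteSpace F]
  {b : HilbertBasis ι 𝕜 E} {c : HilbertBasis κ 𝕜 F} {φ : ι ↪ κ}

lemma ext_hilbertBasis {G : Type*} [NormedAddCommGroup G] [NormedSpace 𝕜 G]
    (b : HilbertBasis ι 𝕜 E) {A B : E →L[𝕜] G} (h : ∀ i, A (b i) = B (b i)) : A = B := by
  refine ContinuousLinearMap.ext_on ?_ (Set.eqOn_range.2 (funext h))
  rw [Submodule.dense_iff_topologicalClosure_eq_top, b.dense_span]

/-- The isometry `E → F` which takes the basis vector `b i` to the basis vector `c (φ i)`. -/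
noncomputable def basisEmbedding (b : HilbertBasis ι 𝕜 E) (c : HilbertBasis κ 𝕜 F) (φ : ι ↪ κ) :
    E →ₗᵢ[𝕜] F :=
  (c.orthonormal.comp φ φ.injective).orthogonalFamily.linearIsometry.comp b.repr.toLinearIsometry

@[simp]
lemma basisEmbedding_basis (b : HilbertBasis ι 𝕜 E) (c : HilbertBasis κ 𝕜 F) (φ : ι ↪ κ) (i : ι) :
    basisEmbedding b c φ (b i) = c (φ i) := by
  classical
  simp [basisEmbedding, b.repr_self]

variable {A : F →L[𝕜] F} {B : E →L[𝕜] E} {σ : κ → κ} {τ : ι → ι}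

lemma comp_basisEmbedding (hA : ∀ k, A (c k) = c (σ k)) (hB : ∀ i, B (b i) = b (τ i))
    (hφ : ∀ i, σ (φ i) = φ (τ i)) :
    A ∘L (basisEmbedding b c φ).toContinuousLinearMap =
      (basisEmbedding b c φ).toContinuousLinearMap ∘L B :=
  ext_hilbertBasis b fun i => by simp [hA, hB, hφ]

variable [CompleteSpace E]

lemma adjoint_basisEmbedding_basis (i : ι) :
    ((basisEmbedding b c φ).toContinuousLinearMap†) (c (φ i)) = b i := by
  rw [← basisEmbedding_basis b]
  exact congr($((basisEmbedding b c φ).adjoint_comp_self) (b i))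

lemma adjoint_basisEmbedding_basis_of_notMem {k : κ} (hk : k ∉ Set.range φ) :
    ((basisEmbedding b c φ).toContinuousLinearMap†) (c k) = 0 := by
  refine b.repr.injective (lp.ext (funext fun i => ?_))
  rw [b.repr_apply_apply, adjoint_inner_right, LinearIsometry.coe_toContinuousLinearMap,
    basisEmbedding_basis, c.orthonormal.inner_eq_zero fun h => hk ⟨i, h⟩, map_zero]
  rfl

lemma adjoint_basisEmbedding_comp (hA : ∀ k, A (c k) = c (σ k)) (hB : ∀ i, B (b i) = b (τ i))
    (hφ : ∀ i, σ (φ i) = φ (τ i)) (hrange : ∀ k, σ k ∈ Set.range φ → k ∈ Set.range φ) :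
    (basisEmbedding b c φ).toContinuousLinearMap† ∘L A =
      B ∘L (basisEmbedding b c φ).toContinuousLinearMap† := by
  refine ext_hilbertBasis c fun k => ?_
  rw [comp_apply, comp_apply, hA]
  by_cases hk : k ∈ Set.range φ
  · obtain ⟨i, rfl⟩ := hk
    rw [hφ, adjoint_basisEmbedding_basis, adjoint_basisEmbedding_basis, hB]
  · rw [adjoint_basisEmbedding_basis_of_notMem hk,
      adjoint_basisEmbedding_basis_of_notMem (mt (hrange k) hk), map_zero]

lemma isIntertwiningFamily_basisEmbedding {φ : α → ι ↪ κ}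
    (hA : ∀ k, A (c k) = c (σ k)) (hB : ∀ i, B (b i) = b (τ i))
    (hφ : ∀ a i, σ (φ a i) = φ a (τ i))
    (hrange : ∀ a k, σ k ∈ Set.range (φ a) → k ∈ Set.range (φ a))
    (hdisj : Pairwise fun a a' => Disjoint (Set.range (φ a)) (Set.range (φ a'))) :
    IsIntertwiningFamily A B fun a => (basisEmbedding b c (φ a)).toContinuousLinearMap where
  adjoint_comp_self a := (basisEmbedding b c (φ a)).adjoint_comp_self
  adjoint_comp_of_ne {a a'} h := ext_hilbertBasis b fun i => by
    have hi : φ a' i ∉ Set.range (φ a) := (hdisj h).notMem_of_mem_right ⟨i, rfl⟩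
    simp [adjoint_basisEmbedding_basis_of_notMem hi]
  comp_eq a := comp_basisEmbedding hA hB (hφ a)
  adjoint_comp_eq a := adjoint_basisEmbedding_comp hA hB (hφ a) (hrange a)

end BasisEmbedding

noncomputable section

/-! ### Monomials and point evaluations in `H²(𝔻²)` -/

section Hardy

lemma toeplitz_apply (p : MvPolynomial (Fin 2) ℂ) (f : H2) (x : ℂ × ℂ) :
    toeplitz p f x = evalAt p x * f x := rfl

lemma norm_apply_le (f : H2) {x : ℂ × ℂ} (hx : x ∈ bidisk) :
    ‖f x‖ ≤ (∑' m : ℕ × ℕ, ‖x.1 ^ m.1 * x.2 ^ m.2‖) * ‖f‖ := by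
  have hs : Summable fun m : ℕ × ℕ => ‖x.1 ^ m.1 * x.2 ^ m.2‖ := by
    simpa using summable_monomials (a := fun _ => 1) (C := 1) (by simp) hx
  rw [mul_comm, ← (f.hasSum hx).tsum_eq]
  refine tsum_of_norm_bounded (hs.hasSum.mul_left _) fun m => ?_
  rw [mul_assoc, norm_mul, H2.norm_def, hardyNorm_eq]
  gcongr
  exact lp.norm_apply_le_norm two_ne_zero (toCoeff f) m

/-- Evaluation at a point of the bidisk, as a bounded functional on `H²(𝔻²)`. -/
def evalCLM {x : ℂ × ℂ} (hx : x ∈ bidisk) : H2 →L[ℂ] ℂ :=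
  LinearMap.mkContinuous
    { toFun := fun f => f x
      map_add' := fun _ _ => rfl
      map_smul' := fun _ _ => rfl } _ fun f => norm_apply_le f hx

lemma evalCLM_apply {x : ℂ × ℂ} (hx : x ∈ bidisk) (f : H2) : evalCLM hx f = f x := rfl

/-- The monomials `zᵃ wᵇ`, indexed by `(a, b)`, as a Hilbert basis of `H²(𝔻²)`. -/
def monomialBasis : HilbertBasis (ℕ × ℕ) ℂ H2 := .ofRepr coeffEquiv

lemma monomialBasis_apply (m : ℕ × ℕ) {x : ℂ × ℂ} (hx : x ∈ bidisk) :
    monomialBasis m x = x.1 ^ m.1 * x.2 ^ m.2 := by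
  classical
  have hcoeff : toCoeff (monomialBasis m) = lp.single 2 m (1 : ℂ) := monomialBasis.repr_self m
  have hsum := (monomialBasis m).hasSum hx
  rw [hcoeff] at hsum
  refine hsum.unique ?_
  convert hasSum_single m fun k hk => ?_
  · simp
  · simp [hk]

lemma toeplitz_X_zero_monomialBasis (m : ℕ × ℕ) :
    toeplitz (X 0) (monomialBasis m) = monomialBasis (m.1 + 1, m.2) := by
  refine H2.ext fun x hx => ?_
  rw [toeplitz_apply, monomialBasis_apply m hx, monomialBasis_apply _ hx, evalAt, eval_X]
  simp only [Matrix.cons_val_zero, pow_succ']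
  ring

end Hardy

/-! ### The isometries `f(z, w) ↦ wⁱ f(z, wⁿ)` -/

section Slices

variable {n : ℕ} [NeZero n]

lemma pow_mem_bidisk {z w : ℂ} (h : (z, w) ∈ bidisk) : (z, w ^ n) ∈ bidisk := by
  have hw : ‖w‖ < 1 := by simpa using h.2
  exact ⟨h.1, by simpa using pow_lt_one₀ (norm_nonneg w) hw (NeZero.ne n)⟩

/-- The injection `(a, b) ↦ (a, b n + i)` of exponents which describes `f(z, w) ↦ wⁱ f(z, wⁿ)` on
monomials. -/
def spread (i : Fin n) : ℕ × ℕ ↪ ℕ × ℕ :=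
  (Function.Embedding.refl ℕ).prodMap
    ((Function.Embedding.sectL ℕ i).trans (Nat.divModEquiv n).symm.toEmbedding)

lemma spread_apply (i : Fin n) (m : ℕ × ℕ) : spread i m = (m.1, m.2 * n + i) := rfl

lemma mem_range_spread {i : Fin n} {k : ℕ × ℕ} : k ∈ Set.range (spread i) ↔ k.2 % n = i := by
  constructor
  · rintro ⟨m, rfl⟩
    simp [spread_apply, Nat.mod_eq_of_lt i.2]
  · intro hk
    exact ⟨(k.1, k.2 / n), by rw [spread_apply, ← hk, Nat.div_add_mod']⟩

/-- The isometry `f(z, w) ↦ wⁱ f(z, wⁿ)` of `H²(𝔻²)`. -/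
def insertSlice (i : Fin n) : H2 →L[ℂ] H2 :=
  (basisEmbedding monomialBasis monomialBasis (spread i)).toContinuousLinearMap

lemma insertSlice_apply (i : Fin n) (f : H2) {z w : ℂ} (h : (z, w) ∈ bidisk) :
    insertSlice i f (z, w) = w ^ (i : ℕ) * f (z, w ^ n) := by
  suffices evalCLM h ∘L insertSlice i = w ^ (i : ℕ) • evalCLM (pow_mem_bidisk h) from
    congr($this f)
  refine ext_hilbertBasis monomialBasis fun m => ?_
  have hm : insertSlice i (monomialBasis m) = monomialBasis (spread i m) :=
    basisEmbedding_basis _ _ _ m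
  rw [ContinuousLinearMap.comp_apply, smul_apply, hm, evalCLM_apply,
    evalCLM_apply, monomialBasis_apply _ h, monomialBasis_apply _ (pow_mem_bidisk h), spread_apply,
    smul_eq_mul]
  ring

lemma isIntertwiningFamily_insertSlice :
    IsIntertwiningFamily (toeplitz (X 0)) (toeplitz (X 0)) (insertSlice (n := n)) := by
  refine isIntertwiningFamily_basisEmbedding toeplitz_X_zero_monomialBasis
    toeplitz_X_zero_monomialBasis (fun i m => rfl) (fun i k hk => ?_) fun i j hij => ?_
  · rw [mem_range_spread] at hk ⊢
    exact hk
  · refine Set.disjoint_left.2 fun k hi hj => hij (Fin.ext ?_)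
    rw [← mem_range_spread.1 hi, mem_range_spread.1 hj]

end Slices

/-! ### Principal submodules -/

section Principal

variable {n : ℕ} {p q : MvPolynomial (Fin 2) ℂ}

lemma isClosed_principal : IsClosed (principal p : Set H2) :=
  Submodule.isClosed_topologicalClosure _

lemma polyH2_mem_principal (g : MvPolynomial (Fin 2) ℂ) : polyH2 (g * p) ∈ principal p :=
  Submodule.le_topologicalClosure _ (Submodule.subset_span ⟨g, rfl⟩)

lemma principal_le {M : Submodule ℂ H2} (hM : IsClosed (M : Set H2))
    (h : ∀ g, polyH2 (g * p) ∈ M) : principal p ≤ M :=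
  Submodule.topologicalClosure_minimal _ (Submodule.span_le.2 (Set.range_subset_iff.2 h)) hM

lemma map_mem_of_mem_principal {M : Submodule ℂ H2} (hM : IsClosed (M : Set H2)) {A : H2 →L[ℂ] H2}
    (h : ∀ g, A (polyH2 (g * p)) ∈ M) : ∀ f ∈ principal p, A f ∈ M :=
  principal_le (M := M.comap A.toLinearMap) (hM.preimage A.continuous) h

lemma principal_ne_top {x : ℂ × ℂ} (hx : x ∈ bidisk) (hq : evalAt q x = 0) :
    principal q ≠ ⊤ := by
  intro htop
  have hvanish (g : MvPolynomial (Fin 2) ℂ) : polyH2 (g * q) ∈ (evalCLM hx).ker := by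
    change polyH2 (g * q) x = 0
    rw [polyH2_apply _ hx, evalAt, map_mul, ← evalAt, ← evalAt, hq, mul_zero]
  have hle : principal q ≤ (evalCLM hx).ker := principal_le (evalCLM hx).isClosed_ker hvanish
  have hone : polyH2 1 x = 0 := hle (htop ▸ Submodule.mem_top : polyH2 1 ∈ principal q)
  simp [polyH2_apply _ hx, evalAt] at hone

lemma nontrivial_quotientModule {x : ℂ × ℂ} (hx : x ∈ bidisk) (hq : evalAt q x = 0) :
    Nontrivial (quotientModule q) := by
  have : CompleteSpace (principal q) := isClosed_principal.completeSpace_coe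
  rw [Submodule.nontrivial_iff_ne_bot, Ne, Submodule.orthogonal_eq_bot_iff]
  exact principal_ne_top hx hq

lemma polyH2_add (g h : MvPolynomial (Fin 2) ℂ) : polyH2 (g + h) = polyH2 g + polyH2 h := by
  refine H2.ext fun x hx => ?_
  change _ = polyH2 g x + polyH2 h x
  rw [polyH2_apply _ hx, polyH2_apply _ hx, polyH2_apply _ hx, evalAt, map_add]
  rfl

/-- The substitution `g(z, w) ↦ g(z, wⁿ)`. -/
def powSubst (n : ℕ) : MvPolynomial (Fin 2) ℂ →ₐ[ℂ] MvPolynomial (Fin 2) ℂ :=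
  aeval ![X 0, X 1 ^ n]

lemma evalAt_powSubst (g : MvPolynomial (Fin 2) ℂ) (z w : ℂ) :
    evalAt (powSubst n g) (z, w) = evalAt g (z, w ^ n) := by
  simp only [evalAt, powSubst, ← coe_aeval_eq_eval, RingHom.coe_coe]
  rw [← AlgHom.comp_apply, comp_aeval]
  congr 2
  ext i
  fin_cases i <;> simp

lemma monomial_eq_X_pow_mul_powSubst (n : ℕ) (s : Fin 2 →₀ ℕ) (c : ℂ) :
    monomial s c = X 1 ^ (s 1 % n) * powSubst n (C c * X 0 ^ s 0 * X 1 ^ (s 1 / n)) := by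
  rw [monomial_eq, Finsupp.prod_fintype _ _ (by simp), Fin.prod_univ_two]
  simp only [powSubst, map_mul, map_pow, aeval_X, aeval_C, algebraMap_eq, Matrix.cons_val_zero,
    Matrix.cons_val_one, ← pow_mul]
  conv_lhs => rw [← Nat.mod_add_div (s 1) n, pow_add]
  ring

variable [NeZero n]

lemma insertSlice_polyH2 (i : Fin n) (g : MvPolynomial (Fin 2) ℂ) :
    insertSlice i (polyH2 g) = polyH2 (X 1 ^ (i : ℕ) * powSubst n g) := by
  refine H2.ext fun x hx => ?_
  rw [insertSlice_apply i _ hx, polyH2_apply _ hx, polyH2_apply _ (pow_mem_bidisk hx),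
    ← evalAt_powSubst]
  simp [evalAt]

lemma insertSlice_mem_principal (i : Fin n) :
    ∀ f ∈ principal q, insertSlice i f ∈ principal (powSubst n q) :=
  map_mem_of_mem_principal isClosed_principal fun g => by
    rw [insertSlice_polyH2, map_mul, ← mul_assoc]
    exact polyH2_mem_principal _

-- On monomials the adjoint extracts `fᵢ` from `∑ᵢ wⁱ fᵢ(z, wⁿ)`, and `g ↦ g q(z, wⁿ)` respects
-- this decomposition.
lemma adjoint_insertSlice_mem_principal (i : Fin n) :
    ∀ f ∈ principal (powSubst n q), ((insertSlice i)†) f ∈ principal q := by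
  refine map_mem_of_mem_principal isClosed_principal fun g => ?_
  induction g using MvPolynomial.induction_on' with
  | monomial s c =>
    rw [monomial_eq_X_pow_mul_powSubst n, mul_assoc, ← map_mul, ← Fin.val_ofNat n (s 1),
      ← insertSlice_polyH2, isIntertwiningFamily_insertSlice.adjoint_apply_apply]
    split_ifs
    · exact polyH2_mem_principal _
    · exact zero_mem _
  | add g h hg hh =>
    rw [add_mul, polyH2_add, map_add]
    exact add_mem hg hh

/-- The isometry `f(z, w) ↦ wⁱ f(z, wⁿ)` from `[q]^⊥` to `[q(z, wⁿ)]^⊥`. -/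
def insertSliceQuotient (q : MvPolynomial (Fin 2) ℂ) (i : Fin n) :
    quotientModule q →L[ℂ] quotientModule (powSubst n q) :=
  (insertSlice i).restrict (apply_mem_orthogonal (adjoint_insertSlice_mem_principal i))

theorem isIntertwiningFamily_insertSliceQuotient (q : MvPolynomial (Fin 2) ℂ) :
    IsIntertwiningFamily (compressedShift (powSubst n q)) (compressedShift q)
      (insertSliceQuotient (n := n) q) :=
  isIntertwiningFamily_insertSlice.compression _ fun i => apply_mem_orthogonal <| by
    simpa only [ContinuousLinearMap.adjoint_adjoint] using insertSlice_mem_principal i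

end Principal

end

end BidiskHardy

open BidiskHardy in
theorem mainTheorem12_general (p q : MvPolynomial (Fin 2) ℂ) (n : ℕ) (hn : 2 ≤ n)
    (hzero : ∃ x ∈ bidisk, evalAt p x = 0)
    (hpq : p = MvPolynomial.aeval ![MvPolynomial.X 0, MvPolynomial.X 1 ^ n] q) :
    IsReducible (compressedShift p) ∧
      ((n ^ 2 : ℕ) : Cardinal) ≤
        Module.rank ℂ (commutantAlgebra (compressedShift p)).toStarSubalgebra := by
  change p = powSubst n q at hpq
  subst hpq
  obtain ⟨⟨z, w⟩, hx, hzw⟩ := hzero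
  have : NeZero n := ⟨by omega⟩
  have : Nontrivial (Fin n) := Fin.nontrivial_iff_two_le.2 hn
  have : Nontrivial (quotientModule q) :=
    nontrivial_quotientModule (pow_mem_bidisk hx) ((evalAt_powSubst q z w).symm.trans hzw)
  have hfamily := isIntertwiningFamily_insertSliceQuotient (n := n) q
  exact ⟨hfamily.isReducible, by simpa only [Fintype.card_fin] using
    hfamily.card_sq_le_rank_commutantAlgebra⟩

theorem mainTheorem12 (p q : MvPolynomial (Fin 2) ℂ) (n : ℕ) (hn : 2 ≤ n)
    (hz : BidiskHardy.NoFactorInZ p) (hdiv : BidiskHardy.HasDivisorProperty p)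
    (hzero : ∃ x ∈ BidiskHardy.bidisk, BidiskHardy.evalAt p x = 0)
    (hpq : p = MvPolynomial.aeval ![MvPolynomial.X 0, MvPolynomial.X 1 ^ n] q) :
    BidiskHardy.IsReducible (BidiskHardy.compressedShift p) ∧
      ((n ^ 2 : ℕ) : Cardinal) ≤
        Module.rank ℂ (BidiskHardy.commutantAlgebra (BidiskHardy.compressedShift p)).toStarSubalgebra :=
  mainTheorem12_general p q n hn hzero hpq
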